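/- Let $d\ge 1$ and $v\ge d+1$ be integers, let $t_1,\dots,t_v$ be distinct real numbers, and let $C(v,d)\subset\mathbb{R}^d$ be the cyclic polytope $$C(v,d)=\operatorname{conv}\{(t_i,t_i^2,\dots,t_i^d) : 1\le i\le v\},$$ the convex hull of $v$ points on the moment curve. For $-1\le k\le d-1$ let $f_k$ be the number of $k$-dimensional faces of $C(v,d)$ (the empty set being the only face of dimension $-1$), and put $f_d=1$. Then the sequence $f_{-1},f_0,\dots,f_{d-1},f_d$ is log-concave: $$f_{i-1}f_{i+1}\le f_i^2\qquad\text{for all integers } i \text{ with } -1<i<d.$$ In particular, the $f$-vector of $C(v,d)$ is unimodal: there is an index $j$ with $-1\le j\le d-1$ such that $$f_{-1}\le f_0\le\dots\le f_j\ge f_{j+1}\ge\dots\ge f_{d-1}.$$ -/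

import Mathlib

noncomputable section

/-- The point `(t, t², …, t^d)` of the moment curve in `ℝ^d`. -/
def momentCurve (d : ℕ) (t : ℝ) : Fin d → ℝ := fun i => t ^ ((i : ℕ) + 1)

/-- The cyclic polytope in `ℝ^d` spanned by the points of the moment curve whose parameters lie
in the finite set `T`. -/
def cyclicPolytope (d : ℕ) (T : Finset ℝ) : Set (Fin d → ℝ) :=
  convexHull ℝ (momentCurve d '' (T : Set ℝ))

open Classical in
/-- The dimension of a subset of a real vector space: the dimension of its affine hull, with the
convention that the empty set has dimension `-1`. -/
def affineDimension {E : Type*} [AddCommGroup E] [Module ℝ E] (F : Set E) : ℤ :=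
  if F = ∅ then -1 else (Module.finrank ℝ (vectorSpan ℝ F) : ℤ)

/-- The `k`-dimensional faces of `P`. A face is the empty set or the set of all points of `P` at
which some linear functional attains its maximum over `P` (this is `IsExposed`); so `∅` and, for
the zero functional, `P` itself are faces. -/
def facesOfDimension {E : Type*} [AddCommGroup E] [Module ℝ E] [TopologicalSpace E]
    (P : Set E) (k : ℤ) : Set (Set E) :=
  {F | IsExposed ℝ P F ∧ affineDimension F = k}

/-- The number `f_k` of `k`-dimensional faces of `P`. -/
def faceNumber {E : Type*} [AddCommGroup E] [Module ℝ E] [TopologicalSpace E]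
    (P : Set E) (k : ℤ) : ℕ :=
  (facesOfDimension P k).ncard

/-- The sequence `f_{-1}, f_0, …, f_{d-1}` of face numbers of `P`, followed by `f_d = 1`. -/
def extendedFVector {E : Type*} [AddCommGroup E] [Module ℝ E] [TopologicalSpace E]
    (d : ℕ) (P : Set E) (k : ℤ) : ℕ :=
  if k = d then 1 else faceNumber P k

/-- Log-concavity of a sequence `f_{-1}, f_0, …, f_d`. -/
def IsLogConcaveSeq (d : ℕ) (f : ℤ → ℕ) : Prop :=
  ∀ i : ℤ, -1 < i → i < d → f (i - 1) * f (i + 1) ≤ f i ^ 2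

/-- Unimodality of a sequence `f_{-1}, f_0, …, f_{d-1}`: it increases weakly up to some index `j`
and decreases weakly from there on. -/
def IsUnimodalSeq (d : ℕ) (f : ℤ → ℕ) : Prop :=
  ∃ j : ℤ, -1 ≤ j ∧ j ≤ (d : ℤ) - 1 ∧
    MonotoneOn f (Set.Icc (-1) j) ∧ AntitoneOn f (Set.Icc j ((d : ℤ) - 1))

end

/-!
A linear functional restricted to the moment curve is a polynomial of degree at most `d` without
constant term. Hence the nonempty proper faces of the cyclic polytope on the parameter set `T` are
the simplices spanned by those `W ⊆ T` that are the zero set on `T` of a polynomial of degree at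
most `d` which is nonnegative on `T` (`faceNumber_cyclicPolytope`); here `W` has as many elements as
the face has vertices, because any `d + 1` points of the curve are affinely independent.

The sets `W` are counted by removing the largest element `s` of `T`. If `s ∈ W`, the linear factor
with root `s` can be divided out; if `s ∉ W`, only the sign of the polynomial at a point to the
right of the remaining parameters matters. Each sign change is worth one linear factor, and this
gives recursions for the generating polynomials (`subsetPoly_isFaceSet_insert`,
`subsetPoly_isFaceSetPos_insert`, `subsetPoly_isFaceSetNeg_insert`), which are solved by
`∑ h_i X ^ i (1 + X) ^ (d - i)` with `h_i = C(n + m, m)`, where `m = min i (d - i)` and `T` has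
`n + 1 + d` elements (`subsetPoly_isFaceSet`).

The coefficient of `X ^ k` in this polynomial is the `k`-th term of the `(d - k + 1)`-fold sequence
of partial sums of `h` (`coeff_cyclicPoly`). So three consecutive face numbers are of the form
`a (k + 2)`, `b (k + 1)`, `c k`, where `b` and `c` are the partial sums of `a` and `b`. The sequence
`h` is log-concave, partial sums preserve log-concavity, and `a (k + 2) * c k ≤ b (k + 1) ^ 2` holds
for every log-concave `a` because the ratio of `a` to `b` decreases
(`StronglyLogConcave.mul_partialSums_partialSums_le`). The remaining inequality, between the numbers
of ridges and facets, and the passage from log-concavity to unimodality are elementary.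
-/

/-! ### Log-concave sequences and iterated partial sums -/

/-- Log-concavity of a sequence of natural numbers, in the form `a i * a (j + 1) ≤ a (i + 1) * a j`
for all `i ≤ j`. Unlike the condition for `j = i + 1` alone, it excludes internal zeros. -/
def StronglyLogConcave (a : ℕ → ℕ) : Prop :=
  ∀ i j, i ≤ j → a i * a (j + 1) ≤ a (i + 1) * a j

/-- The sequence of partial sums `a 0 + ⋯ + a k`. -/
def partialSums (a : ℕ → ℕ) (k : ℕ) : ℕ :=
  ∑ i ∈ Finset.range (k + 1), a i

theorem partialSums_zero (a : ℕ → ℕ) : partialSums a 0 = a 0 := by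
  simp [partialSums]

theorem partialSums_succ (a : ℕ → ℕ) (k : ℕ) :
    partialSums a (k + 1) = partialSums a k + a (k + 1) :=
  Finset.sum_range_succ _ _

theorem monotone_partialSums (a : ℕ → ℕ) : Monotone (partialSums a) :=
  monotone_nat_of_le_succ fun k => by rw [partialSums_succ]; omega

namespace StronglyLogConcave

variable {a : ℕ → ℕ}

theorem mul_le_mul_add (ha : StronglyLogConcave a) (i j m : ℕ) (h : i + m ≤ j + 1) :
    a i * a (j + m) ≤ a (i + m) * a j := by
  induction m generalizing i with
  | zero => simp
  | succ m ih =>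
    rcases Nat.eq_zero_or_pos (a (i + 1) * a (j + m)) with h0 | h0
    · have h1 := ha i (j + m) (by omega)
      rw [h0] at h1
      have h2 : a i * a (j + (m + 1)) = 0 := by simpa [add_assoc] using h1
      rw [h2]; exact Nat.zero_le _
    · have h1 := ha i (j + m) (by omega)
      have h2 := ih (i + 1) (by omega)
      have : a (i + 1 + m) = a (i + (m + 1)) := by congr 1; omega
      rw [this] at h2
      exact h1.trans h2

/-- The ratio of a log-concave sequence to its partial sums decreases. -/
theorem mul_partialSums_le (ha : StronglyLogConcave a) {i k : ℕ} (h : i < k) :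
    a (k + 1) * partialSums a i ≤ a (i + 1) * partialSums a k := by
  obtain ⟨m, rfl⟩ : ∃ m, k = i + m := ⟨k - i, by omega⟩
  calc a (i + m + 1) * partialSums a i
      = ∑ l ∈ Finset.range (i + 1), a l * a (i + m + 1) := by
        rw [partialSums, Finset.mul_sum]; simp_rw [mul_comm]
    _ ≤ ∑ l ∈ Finset.range (i + 1), a (i + 1) * a (l + m) := by
        refine Finset.sum_le_sum fun l hl => ?_
        rw [Finset.mem_range] at hl
        obtain hlm | hlm := le_total (l + m) (i + 1)
        · have := ha.mul_le_mul_add l (i + 1) m (by omega)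
          rw [mul_comm (a (i + 1)), show i + m + 1 = i + 1 + m by omega]; exact this
        · have := ha.mul_le_mul_add l (l + m) (i + 1 - l) (by omega)
          rw [show l + m + (i + 1 - l) = i + m + 1 by omega,
            show l + (i + 1 - l) = i + 1 by omega] at this
          exact this
    _ = a (i + 1) * ∑ l ∈ Finset.range (i + 1), a (m + l) := by
        rw [Finset.mul_sum]; simp_rw [add_comm]
    _ ≤ a (i + 1) * partialSums a (i + m) := by
        refine Nat.mul_le_mul_left _ ?_
        rw [_root_.partialSums, show i + m + 1 = m + (i + 1) by omega,
          Finset.sum_range_add _ m (i + 1)]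
        exact Nat.le_add_left _ _

theorem partialSums (ha : StronglyLogConcave a) : StronglyLogConcave (partialSums a) := by
  intro i j hij
  rw [partialSums_succ, partialSums_succ, mul_add, add_mul]
  rcases hij.eq_or_lt with rfl | hij
  · exact (by ring : _ = _).le
  · have := ha.mul_partialSums_le hij
    rw [mul_comm] at this
    omega

theorem iterate_partialSums (ha : StronglyLogConcave a) (m : ℕ) :
    StronglyLogConcave (_root_.partialSums^[m] a) := by
  induction m with
  | zero => exact ha
  | succ m ih => rw [Function.iterate_succ_apply']; exact ih.partialSums

theorem mul_partialSums_partialSums_le (ha : StronglyLogConcave a) (k : ℕ) :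
    a (k + 2) * _root_.partialSums (_root_.partialSums a) k ≤ _root_.partialSums a (k + 1) ^ 2 := by
  calc a (k + 2) * _root_.partialSums (_root_.partialSums a) k
      = ∑ i ∈ Finset.range (k + 1), a (k + 2) * _root_.partialSums a i := by
        rw [_root_.partialSums, Finset.mul_sum]
    _ ≤ ∑ i ∈ Finset.range (k + 1), a (i + 1) * _root_.partialSums a (k + 1) :=
        Finset.sum_le_sum fun i hi => ha.mul_partialSums_le (Finset.mem_range.1 hi)
    _ = (∑ i ∈ Finset.range (k + 1), a (i + 1)) * _root_.partialSums a (k + 1) := by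
        rw [Finset.sum_mul]
    _ ≤ _root_.partialSums a (k + 1) * _root_.partialSums a (k + 1) := by
        refine Nat.mul_le_mul_right _ ?_
        rw [_root_.partialSums, Finset.sum_range_succ' _ (k + 1)]
        exact Nat.le_add_right _ _
    _ = _ := (sq _).symm

end StronglyLogConcave

theorem iterate_partialSums_apply (a : ℕ → ℕ) (m k : ℕ) :
    partialSums^[m + 1] a k = ∑ i ∈ Finset.range (k + 1), a i * (k - i + m).choose m := by
  induction m generalizing k with
  | zero => simp [partialSums]
  | succ m ih =>
    induction k with
    | zero =>
      rw [Function.iterate_succ_apply', partialSums_zero, ih]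
      simp
    | succ k ihk =>
      rw [Function.iterate_succ_apply', partialSums_succ, ← Function.iterate_succ_apply' partialSums,
        ihk, ih, Finset.sum_range_succ _ (k + 1), Finset.sum_range_succ _ (k + 1), ← add_assoc,
        ← Finset.sum_add_distrib]
      congr 1
      · refine Finset.sum_congr rfl fun i hi => ?_
        rw [Finset.mem_range] at hi
        rw [← mul_add, show k + 1 - i + (m + 1) = (k - i + m + 1) + 1 by omega,
          Nat.choose_succ_succ, show k + 1 - i + m = k - i + m + 1 by omega,
          show k - i + (m + 1) = k - i + m + 1 by omega]
        ring
      · simp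

/-! ### The `h`-vector of a cyclic polytope -/

theorem multichoose_succ_mul (n m : ℕ) :
    (n + 1).multichoose (m + 1) * (m + 1) = (n + 1).multichoose m * (n + m + 1) := by
  rw [Nat.multichoose_eq, Nat.multichoose_eq, show n + 1 + (m + 1) - 1 = n + m + 1 by omega,
    show n + 1 + m - 1 = n + m by omega, mul_comm (Nat.choose _ m),
    ← Nat.add_one_mul_choose_eq]

theorem stronglyLogConcave_multichoose (n : ℕ) : StronglyLogConcave (n + 1).multichoose := by
  intro i j hij
  have h1 := multichoose_succ_mul n i
  have h2 := multichoose_succ_mul n j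
  refine Nat.le_of_mul_le_mul_right (c := (i + 1) * (j + 1)) ?_ (by positivity)
  calc (n + 1).multichoose i * (n + 1).multichoose (j + 1) * ((i + 1) * (j + 1))
      = (n + 1).multichoose i * (n + 1).multichoose j * ((n + j + 1) * (i + 1)) := by
        linear_combination (n + 1).multichoose i * (i + 1) * h2
    _ ≤ (n + 1).multichoose i * (n + 1).multichoose j * ((n + i + 1) * (j + 1)) := by
        refine Nat.mul_le_mul_left _ ?_
        nlinarith [Nat.mul_le_mul_left n hij]
    _ = (n + 1).multichoose (i + 1) * (n + 1).multichoose j * ((i + 1) * (j + 1)) := by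
        linear_combination (n + 1).multichoose j * (j + 1) * h1.symm

theorem monotone_multichoose (n : ℕ) : Monotone (n + 1).multichoose :=
  monotone_nat_of_le_succ fun m => by rw [Nat.multichoose_succ_succ]; omega

theorem multichoose_succ_pos (n m : ℕ) : 0 < (n + 1).multichoose m :=
  (Nat.multichoose_zero_right (n + 1) ▸ Nat.one_pos).trans_le (monotone_multichoose n m.zero_le)

/-- The `h`-vector of a cyclic `d`-polytope with `n + 1 + d` vertices, extended by zeros. -/
def cyclicHVector (n d i : ℕ) : ℕ :=
  if i ≤ d then (n + 1).multichoose (min i (d - i)) else 0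

theorem cyclicHVector_pos (n : ℕ) {d i : ℕ} (h : i ≤ d) : 0 < cyclicHVector n d i := by
  rw [cyclicHVector, if_pos h]; exact multichoose_succ_pos _ _

theorem stronglyLogConcave_cyclicHVector (n d : ℕ) : StronglyLogConcave (cyclicHVector n d) := by
  intro i j hij
  rcases hij.eq_or_lt with rfl | hij
  · rw [mul_comm]
  by_cases hj : j + 1 ≤ d
  swap
  · simp [cyclicHVector, hj]
  simp only [cyclicHVector, if_pos hj, if_pos (show i ≤ d by omega),
    if_pos (show i + 1 ≤ d by omega), if_pos (show j ≤ d by omega)]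
  rcases le_or_gt (2 * (j + 1)) d with h1 | h1
  · -- all four indices lie in the increasing half
    rw [min_eq_left (by omega), min_eq_left (by omega), min_eq_left (by omega),
      min_eq_left (by omega)]
    exact stronglyLogConcave_multichoose n i j hij.le
  rcases le_or_gt d (2 * i) with h2 | h2
  · -- all four indices lie in the decreasing half
    rw [min_eq_right (by omega), min_eq_right (by omega), min_eq_right (by omega),
      min_eq_right (by omega)]
    have := stronglyLogConcave_multichoose n (d - (j + 1)) (d - (i + 1)) (by omega)
    rw [show d - (i + 1) + 1 = d - i by omega, show d - (j + 1) + 1 = d - j by omega] at this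
    rw [mul_comm, mul_comm (Nat.multichoose _ (d - (i + 1)))]
    exact this
  · exact Nat.mul_le_mul (monotone_multichoose n (by omega)) (monotone_multichoose n (by omega))

/-! ### Supporting polynomials -/

open Polynomial in
/-- The polynomial `q` has degree less than `e`, vanishes at the points of `T` that lie in `W`, and
is positive at the remaining points of `T`. -/
structure IsSupporting (e : ℕ) (T W : Finset ℝ) (q : ℝ[X]) : Prop where
  degree_lt : q.degree < e
  eval_eq_zero : ∀ t ∈ T, t ∈ W → q.eval t = 0
  eval_pos : ∀ t ∈ T, t ∉ W → 0 < q.eval t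

namespace IsSupporting

open Polynomial

variable {e : ℕ} {T W : Finset ℝ} {q : ℝ[X]} {s c : ℝ}

theorem mono {e' : ℕ} (h : IsSupporting e T W q) (he : e ≤ e') : IsSupporting e' T W q :=
  ⟨h.degree_lt.trans_le (by exact_mod_cast he), h.eval_eq_zero, h.eval_pos⟩

theorem eq_zero (h : IsSupporting 0 T W q) : q = 0 := by
  simpa [Nat.WithBot.lt_zero_iff] using h.degree_lt

theorem mem_iff (h : IsSupporting e T W q) {t : ℝ} (ht : t ∈ T) : t ∈ W ↔ q.eval t = 0 :=
  ⟨h.eval_eq_zero t ht, fun h0 => by_contra fun hW => (h.eval_pos t ht hW).ne' h0⟩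

theorem insert_iff (hW : s ∉ W) :
    IsSupporting e (insert s T) W q ↔ IsSupporting e T W q ∧ 0 < q.eval s := by
  constructor
  · intro h
    exact ⟨⟨h.1, fun t ht => h.2 t (Finset.mem_insert_of_mem ht),
      fun t ht => h.3 t (Finset.mem_insert_of_mem ht)⟩, h.3 s (Finset.mem_insert_self _ _) hW⟩
  · rintro ⟨h, hs⟩
    refine ⟨h.1, fun t ht htW => ?_, fun t ht htW => ?_⟩
    · rcases Finset.mem_insert.1 ht with rfl | ht
      · exact absurd htW hW
      · exact h.2 t ht htW
    · rcases Finset.mem_insert.1 ht with rfl | ht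
      · exact hs
      · exact h.3 t ht htW

theorem insert_insert_iff (hs : s ∉ T) :
    IsSupporting e (insert s T) (insert s W) q ↔ IsSupporting e T W q ∧ q.eval s = 0 := by
  have key : ∀ t ∈ T, (t ∈ insert s W ↔ t ∈ W) := fun t ht => by
    rw [Finset.mem_insert, or_iff_right]
    rintro rfl; exact hs ht
  constructor
  · intro h
    exact ⟨⟨h.1, fun t ht htW => h.2 t (Finset.mem_insert_of_mem ht) ((key t ht).2 htW),
      fun t ht htW => h.3 t (Finset.mem_insert_of_mem ht) (mt (key t ht).1 htW)⟩,
      h.2 s (Finset.mem_insert_self _ _) (Finset.mem_insert_self _ _)⟩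
  · rintro ⟨h, h0⟩
    refine ⟨h.1, fun t ht htW => ?_, fun t ht htW => ?_⟩
    · rcases Finset.mem_insert.1 ht with rfl | ht
      · exact h0
      · exact h.2 t ht ((key t ht).1 htW)
    · rcases Finset.mem_insert.1 ht with rfl | ht
      · exact absurd (Finset.mem_insert_self _ _) htW
      · exact h.3 t ht (mt (key t ht).2 htW)

/-- A linear factor with its root to the right of `T` does not affect signs on `T`. -/
theorem mul_iff (hT : ∀ t ∈ T, t < c) :
    IsSupporting (e + 1) T W ((C c - X) * q) ↔ IsSupporting e T W q := by
  have hdeg : ((C c - X) * q).degree < ((e + 1 : ℕ) : WithBot ℕ) ↔ q.degree < e := by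
    rw [degree_mul, ← neg_sub, degree_neg, degree_X_sub_C]
    cases q.degree with
    | bot => simp
    | coe m =>
      change ((1 + m : ℕ) : WithBot ℕ) < ((e + 1 : ℕ) : WithBot ℕ) ↔ ((m : ℕ) : WithBot ℕ) < (e : ℕ)
      rw [Nat.cast_lt, Nat.cast_lt]
      omega
  have h0 : ∀ t ∈ T, (((C c - X) * q).eval t = 0 ↔ q.eval t = 0) := fun t ht => by
    simp [sub_ne_zero.2 (hT t ht).ne']
  have hpos : ∀ t ∈ T, (0 < ((C c - X) * q).eval t ↔ 0 < q.eval t) := fun t ht => by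
    simp [mul_pos_iff_of_pos_left (sub_pos.2 (hT t ht))]
  constructor
  · exact fun h => ⟨hdeg.1 h.1, fun t ht hW => (h0 t ht).1 (h.2 t ht hW),
      fun t ht hW => (hpos t ht).1 (h.3 t ht hW)⟩
  · exact fun h => ⟨hdeg.2 h.1, fun t ht hW => (h0 t ht).2 (h.2 t ht hW),
      fun t ht hW => (hpos t ht).2 (h.3 t ht hW)⟩

theorem exists_eq_mul (h : q.eval c = 0) : ∃ r, q = (C c - X) * r := by
  obtain ⟨r, rfl⟩ := dvd_iff_isRoot.2 h
  exact ⟨-r, by ring⟩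

/-- Roots to the right of `s` can be divided out: a supporting polynomial that is positive at some
point `s` to the right of `T` can be replaced by one that is positive from `s` on. -/
theorem exists_pos (hT : ∀ t ∈ T, t < s) (h : IsSupporting e T W q) (hs : 0 < q.eval s) :
    ∃ r, IsSupporting e T W r ∧ ∀ x, s ≤ x → 0 < r.eval x := by
  induction e generalizing q with
  | zero => simp [h.eq_zero] at hs
  | succ e ih =>
    by_cases hq : ∀ x, s ≤ x → 0 < q.eval x
    · exact ⟨q, h, hq⟩
    push Not at hq
    obtain ⟨x, hsx, hx⟩ := hq
    obtain ⟨c, hc, hc0⟩ := intermediate_value_Icc' hsx q.continuous.continuousOn ⟨hx, hs.le⟩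
    have hsc : s < c := lt_of_le_of_ne hc.1 (by rintro rfl; exact hs.ne' hc0)
    obtain ⟨r, rfl⟩ := exists_eq_mul hc0
    rw [mul_iff fun t ht => (hT t ht).trans hsc] at h
    have hr : 0 < r.eval s := by
      simpa [mul_pos_iff_of_pos_left (sub_pos.2 hsc)] using hs
    obtain ⟨r', h', hr'⟩ := ih h hr
    exact ⟨r', h'.mono e.le_succ, hr'⟩

end IsSupporting

/-- Some polynomial of degree less than `e` is nonnegative on `T` with zero set `W` there. For
`e = d + 1` this says that `W` consists of the parameters of a face of the cyclic polytope. -/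
def IsFaceSet (e : ℕ) (T W : Finset ℝ) : Prop :=
  ∃ q, IsSupporting e T W q

/-- Variant of `IsFaceSet` that asks for a polynomial which is moreover positive at `σ`. -/
def IsFaceSetPos (σ : ℝ) (e : ℕ) (T W : Finset ℝ) : Prop :=
  ∃ q, IsSupporting e T W q ∧ 0 < q.eval σ

/-- Variant of `IsFaceSet` that asks for a polynomial which is moreover negative at `σ`. -/
def IsFaceSetNeg (σ : ℝ) (e : ℕ) (T W : Finset ℝ) : Prop :=
  ∃ q, IsSupporting e T W q ∧ q.eval σ < 0

section FaceSets

open Polynomial IsSupporting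

variable {e : ℕ} {T W : Finset ℝ} {s σ : ℝ}

theorem isFaceSet_insert (hW : s ∉ W) :
    IsFaceSet e (insert s T) W ↔ IsFaceSetPos s e T W :=
  exists_congr fun _ => insert_iff hW

theorem isFaceSet_insert_insert (hT : ∀ t ∈ T, t < s) :
    IsFaceSet (e + 1) (insert s T) (insert s W) ↔ IsFaceSet e T W := by
  have hs : s ∉ T := fun h => (hT s h).false
  constructor
  · rintro ⟨q, hq⟩
    rw [insert_insert_iff hs] at hq
    obtain ⟨r, rfl⟩ := exists_eq_mul hq.2
    exact ⟨r, (mul_iff hT).1 hq.1⟩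
  · rintro ⟨r, hr⟩
    exact ⟨(C s - X) * r, (insert_insert_iff hs).2 ⟨(mul_iff hT).2 hr, by simp⟩⟩

theorem isFaceSetPos_insert (hT : ∀ t ∈ T, t < s) (hσ : s < σ) (hW : s ∉ W) :
    IsFaceSetPos σ e (insert s T) W ↔ IsFaceSetPos s e T W := by
  constructor
  · rintro ⟨q, hq, -⟩
    exact ⟨q, (insert_iff hW).1 hq⟩
  · rintro ⟨q, hq, hs⟩
    obtain ⟨r, hr, hpos⟩ := hq.exists_pos hT hs
    exact ⟨r, (insert_iff hW).2 ⟨hr, hpos s le_rfl⟩, hpos σ hσ.le⟩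

theorem isFaceSetPos_insert_insert (hT : ∀ t ∈ T, t < s) (hσ : s < σ) :
    IsFaceSetPos σ (e + 1) (insert s T) (insert s W) ↔ IsFaceSetNeg σ e T W := by
  have hs : s ∉ T := fun h => (hT s h).false
  have key : ∀ r : ℝ[X], 0 < ((C s - X) * r).eval σ ↔ r.eval σ < 0 := fun r => by
    have h := sub_neg.2 hσ
    simp [mul_pos_iff, h, h.not_gt]
  constructor
  · rintro ⟨q, hq, hpos⟩
    rw [insert_insert_iff hs] at hq
    obtain ⟨r, rfl⟩ := exists_eq_mul hq.2
    exact ⟨r, (mul_iff hT).1 hq.1, (key r).1 hpos⟩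
  · rintro ⟨r, hr, hneg⟩
    exact ⟨(C s - X) * r, (insert_insert_iff hs).2 ⟨(mul_iff hT).2 hr, by simp⟩, (key r).2 hneg⟩

theorem isFaceSetNeg_insert_insert (hT : ∀ t ∈ T, t < s) (hσ : s < σ) :
    IsFaceSetNeg σ (e + 1) (insert s T) (insert s W) ↔ IsFaceSetPos σ e T W := by
  have hs : s ∉ T := fun h => (hT s h).false
  have key : ∀ r : ℝ[X], ((C s - X) * r).eval σ < 0 ↔ 0 < r.eval σ := fun r => by
    have h := sub_neg.2 hσ
    simp [mul_neg_iff, h, h.not_gt]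
  constructor
  · rintro ⟨q, hq, hneg⟩
    rw [insert_insert_iff hs] at hq
    obtain ⟨r, rfl⟩ := exists_eq_mul hq.2
    exact ⟨r, (mul_iff hT).1 hq.1, (key r).1 hneg⟩
  · rintro ⟨r, hr, hpos⟩
    exact ⟨(C s - X) * r, (insert_insert_iff hs).2 ⟨(mul_iff hT).2 hr, by simp⟩, (key r).2 hpos⟩

/-- The sign change between `s` and `σ` costs exactly one linear factor. -/
theorem isFaceSetNeg_insert (hT : ∀ t ∈ T, t < s) (hσ : s < σ) (hW : s ∉ W) :
    IsFaceSetNeg σ (e + 1) (insert s T) W ↔ IsFaceSetPos s e T W := by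
  constructor
  · rintro ⟨q, hq, hneg⟩
    rw [insert_iff hW] at hq
    obtain ⟨c, hc, hc0⟩ :=
      intermediate_value_Icc' hσ.le q.continuous.continuousOn ⟨hneg.le, hq.2.le⟩
    have hsc : s < c := lt_of_le_of_ne hc.1 (by rintro rfl; exact hq.2.ne' hc0)
    obtain ⟨r, rfl⟩ := exists_eq_mul hc0
    refine ⟨r, (mul_iff fun t ht => (hT t ht).trans hsc).1 hq.1, ?_⟩
    simpa [mul_pos_iff_of_pos_left (sub_pos.2 hsc)] using hq.2
  · rintro ⟨q, hq, hs⟩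
    obtain ⟨r, hr, hpos⟩ := hq.exists_pos hT hs
    obtain ⟨c, hsc, hcσ⟩ := exists_between hσ
    refine ⟨(C c - X) * r, (insert_iff hW).2
      ⟨(mul_iff fun t ht => (hT t ht).trans hsc).2 hr, ?_⟩, ?_⟩
    · simpa using mul_pos (sub_pos.2 hsc) (hpos s le_rfl)
    · simpa using mul_neg_of_neg_of_pos (sub_neg.2 hcσ) (hpos σ hσ.le)

end FaceSets

/-! ### Generating polynomials of families of face sets -/

open Polynomial Classical in
/-- The polynomial in which the coefficient of `X ^ k` is the number of `k`-element subsets of `T`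
with the property `p`. -/
noncomputable def subsetPoly (T : Finset ℝ) (p : Finset ℝ → Prop) : ℕ[X] :=
  ∑ W ∈ T.powerset, if p W then X ^ W.card else 0

open Polynomial in
/-- The polynomial `∑ C(n + i - 1, i) X ^ i (1 + X) ^ (d - i)`, summed over `2 * i ≤ d`. -/
noncomputable def ballPoly (n d : ℕ) : ℕ[X] :=
  ∑ i ∈ Finset.range (d / 2 + 1), (n.multichoose i : ℕ[X]) * X ^ i * (1 + X) ^ (d - i)

open Polynomial in
/-- The polynomial `∑ h_i X ^ i (1 + X) ^ (d - i)` attached to the `h`-vector of a cyclic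
`d`-polytope with `n + 1 + d` vertices. -/
noncomputable def cyclicPoly (n d : ℕ) : ℕ[X] :=
  ∑ i ∈ Finset.range (d + 1), (cyclicHVector n d i : ℕ[X]) * X ^ i * (1 + X) ^ (d - i)

section Generating

open Polynomial

variable {T : Finset ℝ} {s σ : ℝ}

theorem coeff_subsetPoly (T : Finset ℝ) (p : Finset ℝ → Prop) [DecidablePred p] (k : ℕ) :
    (subsetPoly T p).coeff k = ((T.powersetCard k).filter p).card := by
  rw [subsetPoly, finsetSum_coeff, Finset.card_filter, Finset.powersetCard_eq_filter,
    Finset.sum_filter]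
  refine Finset.sum_congr rfl fun W _ => ?_
  by_cases hp : p W <;> simp [hp, coeff_X_pow, eq_comm]

theorem subsetPoly_congr {p q : Finset ℝ → Prop} (h : ∀ W ⊆ T, (p W ↔ q W)) :
    subsetPoly T p = subsetPoly T q := by
  rw [subsetPoly, subsetPoly]
  refine Finset.sum_congr rfl fun W hW => ?_
  have hW := h W (Finset.mem_powerset.1 hW)
  by_cases hq : q W
  · rw [if_pos hq, if_pos (hW.2 hq)]
  · rw [if_neg hq, if_neg (mt hW.1 hq)]

theorem subsetPoly_insert (hs : s ∉ T) (p : Finset ℝ → Prop) :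
    subsetPoly (insert s T) p = subsetPoly T p + X * subsetPoly T fun W => p (insert s W) := by
  rw [subsetPoly, Finset.sum_powerset_insert hs, subsetPoly, subsetPoly, Finset.mul_sum]
  congr 1
  refine Finset.sum_congr rfl fun W hW => ?_
  rw [Finset.card_insert_of_notMem fun h => hs (Finset.mem_powerset.1 hW h), pow_succ']
  split_ifs <;> simp

theorem subsetPoly_empty {p : Finset ℝ → Prop} (h : p ∅) : subsetPoly ∅ p = 1 := by
  simp [subsetPoly, h]

theorem subsetPoly_eq_zero {p : Finset ℝ → Prop} (h : ∀ W, ¬ p W) : subsetPoly T p = 0 := by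
  simp [subsetPoly, h]

theorem subsetPoly_isFaceSetPos_zero : subsetPoly T (IsFaceSetPos σ 0 T) = 0 :=
  subsetPoly_eq_zero fun _ ⟨_, hq, hpos⟩ => by simp [hq.eq_zero] at hpos

theorem subsetPoly_isFaceSetNeg_zero : subsetPoly T (IsFaceSetNeg σ 0 T) = 0 :=
  subsetPoly_eq_zero fun _ ⟨_, hq, hneg⟩ => by simp [hq.eq_zero] at hneg

theorem subsetPoly_isFaceSet_insert (hT : ∀ t ∈ T, t < s) (e : ℕ) :
    subsetPoly (insert s T) (IsFaceSet (e + 1) (insert s T)) =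
      subsetPoly T (IsFaceSetPos s (e + 1) T) + X * subsetPoly T (IsFaceSet e T) := by
  have hs : s ∉ T := fun h => (hT s h).false
  rw [subsetPoly_insert hs, subsetPoly_congr fun W hW => isFaceSet_insert fun h => hs (hW h),
    subsetPoly_congr fun W _ => isFaceSet_insert_insert hT]

theorem subsetPoly_isFaceSetPos_insert (hT : ∀ t ∈ T, t < s) (hσ : s < σ) (e : ℕ) :
    subsetPoly (insert s T) (IsFaceSetPos σ (e + 1) (insert s T)) =
      subsetPoly T (IsFaceSetPos s (e + 1) T) + X * subsetPoly T (IsFaceSetNeg σ e T) := by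
  have hs : s ∉ T := fun h => (hT s h).false
  rw [subsetPoly_insert hs,
    subsetPoly_congr fun W hW => isFaceSetPos_insert hT hσ fun h => hs (hW h),
    subsetPoly_congr fun W _ => isFaceSetPos_insert_insert hT hσ]

theorem subsetPoly_isFaceSetNeg_insert (hT : ∀ t ∈ T, t < s) (hσ : s < σ) (e : ℕ) :
    subsetPoly (insert s T) (IsFaceSetNeg σ (e + 1) (insert s T)) =
      subsetPoly T (IsFaceSetPos s e T) + X * subsetPoly T (IsFaceSetPos σ e T) := by
  have hs : s ∉ T := fun h => (hT s h).false
  rw [subsetPoly_insert hs,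
    subsetPoly_congr fun W hW => isFaceSetNeg_insert hT hσ fun h => hs (hW h),
    subsetPoly_congr fun W _ => isFaceSetNeg_insert_insert hT hσ]

theorem exists_eq_insert_max {m : ℕ} (h : T.card = m + 1) :
    ∃ s T', T = insert s T' ∧ (∀ t ∈ T', t < s) ∧ T'.card = m := by
  have hne : T.Nonempty := Finset.card_pos.1 (by omega)
  refine ⟨T.max' hne, T.erase (T.max' hne), (Finset.insert_erase (T.max'_mem hne)).symm,
    fun t ht => T.lt_max'_of_mem_erase_max' hne ht, ?_⟩
  rw [Finset.card_erase_of_mem (T.max'_mem hne), h, Nat.add_sub_cancel]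

theorem subsetPoly_empty_isFaceSetPos (e : ℕ) : subsetPoly ∅ (IsFaceSetPos σ (e + 1) ∅) = 1 :=
  subsetPoly_empty ⟨1, ⟨by rw [degree_one]; exact_mod_cast e.succ_pos, by simp, by simp⟩, by simp⟩

theorem subsetPoly_empty_isFaceSetNeg (e : ℕ) : subsetPoly ∅ (IsFaceSetNeg σ (e + 1) ∅) = 1 :=
  subsetPoly_empty ⟨-1, ⟨by rw [degree_neg, degree_one]; exact_mod_cast e.succ_pos, by simp,
    by simp⟩, by simp⟩

/-- Every subset of a set of at most `d` points is a face set. -/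
theorem subsetPoly_isFaceSetPos_of_card_le {d m : ℕ} (hT : T.card = m) (hσ : ∀ t ∈ T, t < σ)
    (h : m ≤ d) : subsetPoly T (IsFaceSetPos σ (d + 1) T) = (1 + X) ^ m := by
  induction m using Nat.strong_induction_on generalizing T σ d with
  | _ m ih =>
  obtain _ | m := m
  · rw [Finset.card_eq_zero.1 hT, subsetPoly_empty_isFaceSetPos, pow_zero]
  obtain ⟨d, rfl⟩ : ∃ d', d = d' + 1 := ⟨d - 1, by omega⟩
  obtain ⟨s, T, rfl, hs, hT⟩ := exists_eq_insert_max hT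
  have hsσ := hσ s (Finset.mem_insert_self _ _)
  rw [subsetPoly_isFaceSetPos_insert hs hsσ, ih m (by omega) hT hs (by omega)]
  obtain _ | m := m
  · rw [Finset.card_eq_zero.1 hT, subsetPoly_empty_isFaceSetNeg]; ring
  obtain ⟨d, rfl⟩ : ∃ d', d = d' + 1 := ⟨d - 1, by omega⟩
  obtain ⟨s', T, rfl, hs', hT⟩ := exists_eq_insert_max hT
  have hss := hs s' (Finset.mem_insert_self _ _)
  rw [subsetPoly_isFaceSetNeg_insert hs' (hss.trans hsσ), ih m (by omega) hT hs' (by omega),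
    ih m (by omega) hT (fun t ht => ((hs' t ht).trans hss).trans hsσ) (by omega)]
  ring

theorem ballPoly_zero_left (d : ℕ) : ballPoly 0 d = (1 + X) ^ d := by
  rw [ballPoly, Finset.sum_range_succ']
  simp

theorem ballPoly_succ_add_two (n d : ℕ) :
    ballPoly (n + 1) (d + 2) = ballPoly n (d + 2) + X * (1 + X) * ballPoly (n + 1) d := by
  have hd : (d + 2) / 2 + 1 = d / 2 + 1 + 1 := by omega
  rw [ballPoly, ballPoly, hd, Finset.sum_range_succ', Finset.sum_range_succ' _ (d / 2 + 1),
    ballPoly, Finset.mul_sum, add_right_comm, ← Finset.sum_add_distrib]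
  congr 1
  · refine Finset.sum_congr rfl fun i hi => ?_
    rw [Finset.mem_range] at hi
    rw [Nat.multichoose_succ_succ, show d + 2 - (i + 1) = d - i + 1 by omega]
    push_cast
    ring
  · simp

theorem subsetPoly_isFaceSetPos {n d : ℕ} (hT : T.card = n + d) (hσ : ∀ t ∈ T, t < σ) :
    subsetPoly T (IsFaceSetPos σ (d + 1) T) = ballPoly n d := by
  induction d using Nat.twoStepInduction generalizing n T σ with
  | zero =>
    rw [show ballPoly n 0 = 1 by simp [ballPoly]]
    induction n generalizing T σ with
    | zero => rw [Finset.card_eq_zero.1 hT, subsetPoly_empty_isFaceSetPos]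
    | succ n ih =>
      obtain ⟨s, T, rfl, hs, hT⟩ := exists_eq_insert_max hT
      rw [subsetPoly_isFaceSetPos_insert hs (hσ s (Finset.mem_insert_self _ _)), ih hT hs,
        subsetPoly_isFaceSetNeg_zero, mul_zero, add_zero]
  | one =>
    rw [show ballPoly n 1 = 1 + X by simp [ballPoly]]
    induction n generalizing T σ with
    | zero =>
      rw [subsetPoly_isFaceSetPos_of_card_le hT hσ (by omega), zero_add, pow_one]
    | succ n ih =>
      obtain ⟨s, T, rfl, hs, hT⟩ := exists_eq_insert_max hT
      have hsσ := hσ s (Finset.mem_insert_self _ _)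
      rw [subsetPoly_isFaceSetPos_insert hs hsσ, ih (by omega) hs]
      obtain ⟨s', T, rfl, hs', hT⟩ := exists_eq_insert_max (T := T) (m := n) (by omega)
      rw [subsetPoly_isFaceSetNeg_insert hs' ((hs s' (Finset.mem_insert_self _ _)).trans hsσ),
        subsetPoly_isFaceSetPos_zero, subsetPoly_isFaceSetPos_zero]
      simp
  | more d ihd _ =>
    induction n generalizing T σ with
    | zero =>
      rw [subsetPoly_isFaceSetPos_of_card_le hT hσ (by omega), zero_add, ballPoly_zero_left]
    | succ n ih =>
      obtain ⟨s, T, rfl, hs, hT⟩ := exists_eq_insert_max (T := T) (m := n + (d + 2)) (by omega)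
      have hsσ := hσ s (Finset.mem_insert_self _ _)
      rw [subsetPoly_isFaceSetPos_insert hs hsσ, ih hT hs]
      obtain ⟨s', T, rfl, hs', hT⟩ := exists_eq_insert_max (T := T) (m := n + 1 + d) (by omega)
      have hss := hs s' (Finset.mem_insert_self _ _)
      rw [subsetPoly_isFaceSetNeg_insert hs' (hss.trans hsσ), ihd hT hs',
        ihd hT fun t ht => ((hs' t ht).trans hss).trans hsσ, ballPoly_succ_add_two]
      ring

theorem cyclicPoly_succ (n d : ℕ) :
    cyclicPoly n (d + 1) = ballPoly n (d + 1) + X * cyclicPoly n d := by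
  have hball : ballPoly n (d + 1) = ∑ i ∈ Finset.range (d + 1 + 1),
      if 2 * i ≤ d + 1 then (n.multichoose i : ℕ[X]) * X ^ i * (1 + X) ^ (d + 1 - i) else 0 := by
    rw [ballPoly, ← Finset.sum_filter]
    refine Finset.sum_congr ?_ fun _ _ => rfl
    ext i
    simp only [Finset.mem_range, Finset.mem_filter]
    omega
  rw [hball, cyclicPoly, Finset.sum_range_succ', Finset.sum_range_succ' _ (d + 1), cyclicPoly,
    Finset.mul_sum, add_right_comm, ← Finset.sum_add_distrib]
  congr 1
  · refine Finset.sum_congr rfl fun i hi => ?_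
    rw [Finset.mem_range] at hi
    rw [cyclicHVector, cyclicHVector, if_pos (show i + 1 ≤ d + 1 by omega),
      if_pos (show i ≤ d by omega),
      show d + 1 - (i + 1) = d - i by omega]
    split_ifs with h
    · rw [min_eq_left (by omega), min_eq_left (by omega), Nat.multichoose_succ_succ]
      push_cast
      ring
    · rw [min_eq_right (by omega), min_eq_right (by omega)]
      ring
  · simp [cyclicHVector]

/-- The generating polynomial of the face sets. The summand `X ^ (n + 1 + d)` belongs to the set
`T` itself, which is a face set through the zero polynomial. -/
theorem subsetPoly_isFaceSet {n d : ℕ} (hT : T.card = n + 1 + d) :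
    subsetPoly T (IsFaceSet (d + 1) T) = cyclicPoly n d + X ^ (n + 1 + d) := by
  have hzero : ∀ T : Finset ℝ, subsetPoly T (IsFaceSet 0 T) = X ^ T.card := fun T => by
    rw [subsetPoly, Finset.sum_eq_single T]
    · rw [if_pos ⟨0, by simp, by simp, fun t ht h => absurd ht h⟩]
    · rintro W hW hne
      refine if_neg fun ⟨q, hq⟩ => hne (Finset.mem_powerset.1 hW |>.antisymm fun t ht => ?_)
      rw [hq.mem_iff ht, hq.eq_zero, eval_zero]
    · simp
  induction d generalizing T with
  | zero =>
    obtain ⟨s, T, rfl, hs, hT⟩ := exists_eq_insert_max (m := n) hT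
    rw [subsetPoly_isFaceSet_insert hs, subsetPoly_isFaceSetPos (n := n) (d := 0) hT hs, hzero, hT]
    simp [ballPoly, cyclicPoly, cyclicHVector, pow_succ']
  | succ d ih =>
    obtain ⟨s, T, rfl, hs, hT⟩ := exists_eq_insert_max (m := n + 1 + d) hT
    rw [subsetPoly_isFaceSet_insert hs, subsetPoly_isFaceSetPos (T := T) (n := n) (by omega) hs,
      ih hT, cyclicPoly_succ]
    ring

theorem coeff_cyclicPoly (n : ℕ) {d k : ℕ} (h : k ≤ d) :
    (cyclicPoly n d).coeff k = partialSums^[d - k + 1] (cyclicHVector n d) k := by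
  rw [iterate_partialSums_apply, cyclicPoly, finsetSum_coeff]
  symm
  refine Finset.sum_subset_zero_on_sdiff (Finset.range_mono (by omega)) ?_ ?_
  · intro i hi
    simp only [Finset.mem_sdiff, Finset.mem_range] at hi
    rw [mul_assoc, coeff_natCast_mul, coeff_X_pow_mul', if_neg (by omega), mul_zero]
  · intro i hi
    rw [Finset.mem_range] at hi
    rw [mul_assoc, coeff_natCast_mul, coeff_X_pow_mul', if_pos (by omega), coeff_one_add_X_pow,
      show k - i + (d - k) = d - i by omega, ← Nat.choose_symm (show k - i ≤ d - i by omega),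
      show d - i - (k - i) = d - k by omega]
    simp

end Generating

/-! ### Faces of cyclic polytopes -/

/-- The face of a polytope cut out by a linear functional is the convex hull of the vertices at
which the functional is maximal. -/
theorem setOf_forall_le_convexHull_image {ι E : Type*} [AddCommGroup E] [Module ℝ E]
    (p : ι → E) {S S₀ : Set ι} (l : E →ₗ[ℝ] ℝ) {c : ℝ} (hne : S₀.Nonempty) (hsub : S₀ ⊆ S)
    (hc : ∀ i ∈ S₀, l (p i) = c) (hlt : ∀ i ∈ S, i ∉ S₀ → l (p i) < c) :
    {x ∈ convexHull ℝ (p '' S) | ∀ y ∈ convexHull ℝ (p '' S), l y ≤ l x} =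
      convexHull ℝ (p '' S₀) := by
  have hle : convexHull ℝ (p '' S) ⊆ {x | l x ≤ c} := by
    refine convexHull_min ?_ (convex_halfSpace_le l.isLinear c)
    rintro _ ⟨i, hi, rfl⟩
    by_cases h : i ∈ S₀
    · exact (hc i h).le
    · exact (hlt i hi h).le
  have heq : convexHull ℝ (p '' S₀) ⊆ {x | l x = c} := by
    refine convexHull_min ?_ (convex_hyperplane l.isLinear c)
    rintro _ ⟨i, hi, rfl⟩
    exact hc i hi
  -- adding the open half-space below the face to the face gives a convex set
  have hconv : Convex ℝ ({x | l x < c} ∪ convexHull ℝ (p '' S₀)) := by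
    intro x hx y hy a b ha hb hab
    have hle' : ∀ z ∈ {x | l x < c} ∪ convexHull ℝ (p '' S₀), l z ≤ c := by
      rintro z (hz | hz)
      exacts [le_of_lt hz, (heq hz).le]
    rcases ha.eq_or_lt with rfl | ha
    · simpa [show b = 1 by linarith] using hy
    rcases hb.eq_or_lt with rfl | hb
    · simpa [show a = 1 by linarith] using hx
    have hx' := hle' x hx
    have hy' := hle' y hy
    have hc' : c = a * c + b * c := by rw [← add_mul, hab, one_mul]
    rcases hx with hx | hx
    · left
      have hx : l x < c := hx
      have h1 := mul_lt_mul_of_pos_left hx ha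
      have h2 := mul_le_mul_of_nonneg_left hy' hb.le
      simp only [Set.mem_ofPred_eq, map_add, map_smul, smul_eq_mul]
      linarith
    · rcases hy with hy | hy
      · left
        have hy : l y < c := hy
        have h1 := mul_le_mul_of_nonneg_left hx' ha.le
        have h2 := mul_lt_mul_of_pos_left hy hb
        simp only [Set.mem_ofPred_eq, map_add, map_smul, smul_eq_mul]
        linarith
      · exact Or.inr (convex_convexHull ℝ _ hx hy ha.le hb.le hab)
  have hcover : convexHull ℝ (p '' S) ⊆ {x | l x < c} ∪ convexHull ℝ (p '' S₀) := by
    refine convexHull_min ?_ hconv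
    rintro _ ⟨i, hi, rfl⟩
    by_cases h : i ∈ S₀
    · exact Or.inr (subset_convexHull ℝ _ ⟨i, h, rfl⟩)
    · exact Or.inl (hlt i hi h)
  have hmono : convexHull ℝ (p '' S₀) ⊆ convexHull ℝ (p '' S) :=
    convexHull_mono (Set.image_mono hsub)
  ext x
  constructor
  · rintro ⟨hx, hmax⟩
    obtain ⟨i, hi⟩ := hne
    have h1 := hmax (p i) (subset_convexHull ℝ _ ⟨i, hsub hi, rfl⟩)
    rw [hc i hi] at h1
    exact (hcover hx).resolve_left fun h => (lt_of_lt_of_le h h1).false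
  · intro hx
    refine ⟨hmono hx, fun y hy => ?_⟩
    rw [show l x = c from heq hx]
    exact hle hy

section Faces

open Polynomial

variable {d : ℕ}

/-- The polynomial function `t ↦ c - l (t, t ^ 2, …, t ^ d)` of a linear functional `l`. -/
noncomputable def functionalPoly (l : (Fin d → ℝ) →ₗ[ℝ] ℝ) (c : ℝ) : ℝ[X] :=
  C c - ∑ i : Fin d, C (l (Pi.single i 1)) * X ^ ((i : ℕ) + 1)

theorem eval_functionalPoly (l : (Fin d → ℝ) →ₗ[ℝ] ℝ) (c t : ℝ) :
    (functionalPoly l c).eval t = c - l (momentCurve d t) := by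
  conv_rhs => rw [l.pi_apply_eq_sum_univ]
  have : ∀ i : Fin d, (fun j => if i = j then (1 : ℝ) else 0) = Pi.single i 1 := fun i => by
    ext j; simp [Pi.single_apply, eq_comm]
  simp only [functionalPoly, eval_sub, eval_C, eval_finsetSum, eval_mul, eval_pow, eval_X, this,
    momentCurve, smul_eq_mul, mul_comm]

theorem degree_functionalPoly_lt (l : (Fin d → ℝ) →ₗ[ℝ] ℝ) (c : ℝ) :
    (functionalPoly l c).degree < ((d + 1 : ℕ) : WithBot ℕ) := by
  rw [← mem_degreeLT]
  refine Submodule.sub_mem _ ?_ (Submodule.sum_mem _ fun i _ => ?_) <;> rw [mem_degreeLT]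
  · exact degree_C_le.trans_lt (by exact_mod_cast d.succ_pos)
  · refine (degree_C_mul_X_pow_le _ _).trans_lt ?_
    exact_mod_cast Nat.succ_lt_succ i.isLt

theorem exists_functional {q : ℝ[X]} (hq : q.degree < ((d + 1 : ℕ) : WithBot ℕ)) :
    ∃ l : (Fin d → ℝ) →L[ℝ] ℝ, ∀ t, q.eval t = q.coeff 0 - l (momentCurve d t) := by
  refine ⟨-∑ i : Fin d, q.coeff (i + 1) • ContinuousLinearMap.proj (R := ℝ) i, fun t => ?_⟩
  have hdeg : q.natDegree < d + 1 := by
    rcases eq_or_ne q 0 with rfl | h0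
    · simp
    · exact (natDegree_lt_iff_degree_lt h0).2 hq
  rw [eval_eq_sum_range' hdeg, Finset.sum_range_succ', Finset.sum_range]
  simp [momentCurve, add_comm]

/-- At most `d + 1` points of the moment curve in `ℝ^d` are affinely independent. -/
theorem affineIndependent_momentCurve {W : Finset ℝ} (hW : W.card ≤ d + 1) :
    AffineIndependent ℝ fun t : W => momentCurve d t := by
  rw [affineIndependent_iff]
  intro s w hsum hw t ht
  -- an affine dependence annihilates all polynomials of degree at most `d`
  have key : ∀ q : ℝ[X], q.degree < ((d + 1 : ℕ) : WithBot ℕ) →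
      ∑ u ∈ s, w u * q.eval (u : ℝ) = 0 := by
    intro q hq
    obtain ⟨l, hl⟩ := exists_functional hq
    have : ∑ u ∈ s, w u * l (momentCurve d u) = 0 := by
      have := congrArg l hw
      simpa [map_sum] using this
    simp_rw [hl, mul_sub, Finset.sum_sub_distrib, this, ← Finset.sum_mul, hsum]
    simp
  have hdeg : (∏ u ∈ W.erase t, (X - C u)).degree < ((d + 1 : ℕ) : WithBot ℕ) := by
    rw [degree_prod]
    simp only [degree_X_sub_C, Finset.sum_const, nsmul_eq_mul, mul_one]
    have : (W.erase t).card < d + 1 :=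
      (Finset.card_lt_card (Finset.erase_ssubset t.2)).trans_le hW
    exact_mod_cast this
  have h := key _ hdeg
  rw [Finset.sum_eq_single_of_mem t ht] at h
  · refine (mul_eq_zero.1 h).resolve_right ?_
    rw [← ne_eq, eval_prod, Finset.prod_ne_zero_iff]
    intro u hu
    simpa [sub_eq_zero] using (Finset.ne_of_mem_erase hu).symm
  · intro u _ hut
    rw [eval_prod, Finset.prod_eq_zero (i := (u : ℝ)), mul_zero]
    · exact Finset.mem_erase.2 ⟨fun h => hut (Subtype.ext h), u.2⟩
    · simp

theorem cyclicPolytope_eq_empty_iff {W : Finset ℝ} : cyclicPolytope d W = ∅ ↔ W = ∅ := by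
  simp [cyclicPolytope]

theorem affineDimension_cyclicPolytope {W : Finset ℝ} (hW : W.card ≤ d + 1) :
    affineDimension (cyclicPolytope d W) = (W.card : ℤ) - 1 := by
  rcases W.eq_empty_or_nonempty with rfl | hne
  · simp [affineDimension, cyclicPolytope]
  obtain ⟨m, hm⟩ : ∃ m, W.card = m + 1 := ⟨W.card - 1, by have := hne.card_pos; omega⟩
  rw [affineDimension, if_neg (mt cyclicPolytope_eq_empty_iff.1 hne.ne_empty), cyclicPolytope,
    ← direction_affineSpan, affineSpan_convexHull, direction_affineSpan]
  have := (affineIndependent_momentCurve hW).finrank_vectorSpan (n := m) (by simpa using hm)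
  rw [show Set.range (fun t : W => momentCurve d t) = momentCurve d '' (W : Set ℝ) by
    ext; simp] at this
  rw [this, hm]
  simp

theorem le_affineDimension_cyclicPolytope {T : Finset ℝ} (hT : d + 1 ≤ T.card) :
    (d : ℤ) ≤ affineDimension (cyclicPolytope d T) := by
  obtain ⟨W, hWT, hW⟩ := Finset.exists_subset_card_eq hT
  have hW0 : W ≠ ∅ := by rintro rfl; simp at hW
  have hT0 : T ≠ ∅ := by rintro rfl; simp at hT
  have h := affineDimension_cyclicPolytope hW.le
  rw [affineDimension, if_neg (mt cyclicPolytope_eq_empty_iff.1 hW0), hW] at h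
  rw [affineDimension, if_neg (mt cyclicPolytope_eq_empty_iff.1 hT0)]
  have hmono : vectorSpan ℝ (cyclicPolytope d W) ≤ vectorSpan ℝ (cyclicPolytope d T) :=
    vectorSpan_mono ℝ (convexHull_mono (Set.image_mono (by exact_mod_cast hWT)))
  have := Submodule.finrank_mono hmono
  push_cast at h
  omega

/-- A linear functional that supports the polytope along the curve points with parameters
in `W` cuts out the face spanned by these points. -/
theorem setOf_forall_le_cyclicPolytope {T W : Finset ℝ} {q : ℝ[X]} {c : ℝ}
    (l : (Fin d → ℝ) →ₗ[ℝ] ℝ) (hl : ∀ t, q.eval t = c - l (momentCurve d t))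
    (hq : IsSupporting (d + 1) T W q) (hWT : W ⊆ T) (hW : W.Nonempty) :
    {x ∈ cyclicPolytope d T | ∀ y ∈ cyclicPolytope d T, l y ≤ l x} = cyclicPolytope d W := by
  refine setOf_forall_le_convexHull_image (c := c) _ l hW (by exact_mod_cast hWT) ?_ ?_
  · intro t ht
    have := hq.eval_eq_zero t (hWT ht) ht
    rw [hl] at this
    linarith
  · intro t ht htW
    have := hq.eval_pos t ht htW
    rw [hl] at this
    linarith

theorem isExposed_cyclicPolytope {T W : Finset ℝ} (hWT : W ⊆ T) (h : IsFaceSet (d + 1) T W) :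
    IsExposed ℝ (cyclicPolytope d T) (cyclicPolytope d W) := by
  intro hne
  have hW : W.Nonempty := by
    rw [Finset.nonempty_iff_ne_empty]
    rintro rfl
    simp [cyclicPolytope] at hne
  obtain ⟨q, hq⟩ := h
  obtain ⟨l, hl⟩ := exists_functional hq.degree_lt
  exact ⟨l, (setOf_forall_le_cyclicPolytope (l : (Fin d → ℝ) →ₗ[ℝ] ℝ) hl hq hWT hW).symm⟩

theorem exists_isFaceSet_of_isExposed {T : Finset ℝ} {F : Set (Fin d → ℝ)}
    (hF : IsExposed ℝ (cyclicPolytope d T) F) :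
    ∃ W ⊆ T, IsFaceSet (d + 1) T W ∧ F = cyclicPolytope d W := by
  classical
  rcases F.eq_empty_or_nonempty with rfl | hne
  · exact ⟨∅, by simp, ⟨1, by rw [degree_one]; exact_mod_cast d.succ_pos, by simp, by simp⟩,
      by simp [cyclicPolytope]⟩
  obtain ⟨l, rfl⟩ := hF hne
  have hT : T.Nonempty := by
    rw [Finset.nonempty_iff_ne_empty]
    rintro rfl
    simp [cyclicPolytope] at hne
  obtain ⟨t₀, ht₀, hmax⟩ := T.exists_max_image (fun t => l (momentCurve d t)) hT
  set c := l (momentCurve d t₀) with hc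
  have heval := eval_functionalPoly (l : (Fin d → ℝ) →ₗ[ℝ] ℝ) c
  have hq : IsSupporting (d + 1) T (T.filter fun t => l (momentCurve d t) = c)
      (functionalPoly (l : (Fin d → ℝ) →ₗ[ℝ] ℝ) c) := by
    refine ⟨degree_functionalPoly_lt _ _, fun t _ htW => ?_, fun t ht htW => ?_⟩
    · rw [heval]
      simp [(Finset.mem_filter.1 htW).2]
    · rw [heval]
      exact sub_pos.2 (lt_of_le_of_ne (hmax t ht) fun h => htW (Finset.mem_filter.2 ⟨ht, h⟩))
  exact ⟨_, Finset.filter_subset _ _, ⟨_, hq⟩, setOf_forall_le_cyclicPolytope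
    (l : (Fin d → ℝ) →ₗ[ℝ] ℝ) heval hq (Finset.filter_subset _ _)
    ⟨t₀, Finset.mem_filter.2 ⟨ht₀, rfl⟩⟩⟩

theorem subset_of_cyclicPolytope_subset {T W W' : Finset ℝ} (hWT : W ⊆ T) (hWT' : W' ⊆ T)
    (h : IsFaceSet (d + 1) T W) (hne : W.Nonempty)
    (hsub : cyclicPolytope d W' ⊆ cyclicPolytope d W) : W' ⊆ W := by
  intro t ht
  obtain ⟨q, hq⟩ := h
  obtain ⟨l, hl⟩ := exists_functional hq.degree_lt
  obtain ⟨u, hu⟩ := hne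
  have hmem : momentCurve d t ∈ cyclicPolytope d W :=
    hsub (subset_convexHull ℝ _ ⟨t, ht, rfl⟩)
  rw [← setOf_forall_le_cyclicPolytope (l : (Fin d → ℝ) →ₗ[ℝ] ℝ) hl hq hWT ⟨u, hu⟩] at hmem
  have h1 : l (momentCurve d u) ≤ l (momentCurve d t) :=
    hmem.2 _ (subset_convexHull ℝ _ ⟨u, hWT hu, rfl⟩)
  by_contra htW
  have h2 := hq.eval_pos t (hWT' ht) htW
  have h3 := hq.eval_eq_zero u (hWT hu) hu
  rw [hl] at h2 h3
  linarith

/-- The `(k - 1)`-dimensional faces of a cyclic polytope correspond to the face sets with `k`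
elements. -/
theorem faceNumber_cyclicPolytope {T : Finset ℝ} {k : ℕ} (hk : k ≤ d) :
    faceNumber (cyclicPolytope d T) ((k : ℤ) - 1) =
      (subsetPoly T (IsFaceSet (d + 1) T)).coeff k := by
  classical
  rw [coeff_subsetPoly, faceNumber, ← Set.ncard_coe_finset]
  symm
  refine Set.ncard_congr (fun W _ => cyclicPolytope d W) ?_ ?_ ?_
  · intro W hW
    simp only [Finset.coe_filter, Finset.mem_powersetCard, Set.mem_ofPred_eq] at hW
    obtain ⟨⟨hWT, hWk⟩, hface⟩ := hW
    exact ⟨isExposed_cyclicPolytope hWT hface, by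
      rw [affineDimension_cyclicPolytope (by omega), hWk]⟩
  · intro W W' hW hW' heq
    simp only [Finset.coe_filter, Finset.mem_powersetCard, Set.mem_ofPred_eq] at hW hW' heq
    obtain ⟨⟨hWT, hWk⟩, hface⟩ := hW
    obtain ⟨⟨hWT', hWk'⟩, hface'⟩ := hW'
    rcases W.eq_empty_or_nonempty with rfl | hne
    · symm
      rw [← Finset.card_eq_zero, hWk', ← hWk, Finset.card_empty]
    · exact (Finset.eq_of_subset_of_card_le
        (subset_of_cyclicPolytope_subset hWT hWT' hface hne heq.ge) (by omega)).symm
  · rintro F ⟨hF, hdim⟩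
    obtain ⟨W, hWT, hface, rfl⟩ := exists_isFaceSet_of_isExposed hF
    -- a face set with more than `d` elements spans all of `ℝ^d`
    have hWd : W.card ≤ d := by
      by_contra! hlt
      have := le_affineDimension_cyclicPolytope (d := d) (T := W) hlt
      omega
    rw [affineDimension_cyclicPolytope (by omega)] at hdim
    refine ⟨W, ?_, rfl⟩
    simp only [Finset.coe_filter, Finset.mem_powersetCard, Set.mem_ofPred_eq]
    exact ⟨⟨hWT, by omega⟩, hface⟩

end Faces

/-! ### Log-concavity and unimodality of the face numbers -/

theorem isUnimodalSeq_of_logConcave {d : ℕ} {f : ℤ → ℕ} (hpos : ∀ i : ℤ, -1 ≤ i → i < d → 0 < f i)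
    (hf : ∀ i : ℤ, -1 < i → i < (d : ℤ) - 1 → f (i - 1) * f (i + 1) ≤ f i ^ 2) :
    IsUnimodalSeq d f := by
  classical
  -- the peak is the first index at which the sequence does not increase strictly
  have hex : ∃ m : ℕ, m = d ∨ f m ≤ f ((m : ℤ) - 1) := ⟨d, Or.inl rfl⟩
  obtain ⟨m, hm, hmin⟩ : ∃ m : ℕ, (m = d ∨ f m ≤ f ((m : ℤ) - 1)) ∧
      ∀ l < m, ¬ (l = d ∨ f l ≤ f ((l : ℤ) - 1)) :=
    ⟨Nat.find hex, Nat.find_spec hex, fun l hl => Nat.find_min hex hl⟩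
  have hmd : m ≤ d := by
    by_contra! h
    exact hmin d h (Or.inl rfl)
  have hdesc : ∀ i : ℤ, (m : ℤ) - 1 ≤ i → i + 1 ≤ (d : ℤ) - 1 → f (i + 1) ≤ f i := by
    intro i hi
    induction i, hi using Int.leInduction with
    | base =>
      intro h
      rw [sub_add_cancel]
      exact hm.resolve_left (by omega)
    | succ i hi ih =>
      intro h
      have h1 := ih (by omega)
      have h2 := hf (i + 1) (by omega) (by omega)
      rw [add_sub_cancel_right] at h2
      refine Nat.le_of_mul_le_mul_left (h2.trans ?_) (hpos i (by omega) (by omega))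
      rw [sq]
      exact Nat.mul_le_mul_right _ h1
  refine ⟨(m : ℤ) - 1, by omega, by omega, ?_, ?_⟩
  · refine monotoneOn_of_le_add_one Set.ordConnected_Icc fun i _ hi hi' => ?_
    obtain ⟨l, hl⟩ := Int.eq_ofNat_of_zero_le (a := i + 1) (by have := hi.1; omega)
    have h := hmin l (by have := hi'.2; omega)
    have hi : (l : ℤ) - 1 = i := by omega
    rw [hi, ← hl] at h
    exact (not_le.1 (not_or.1 h).2).le
  · exact antitoneOn_of_add_one_le Set.ordConnected_Icc fun i _ hi hi' => hdesc i hi.1 hi'.2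

theorem faceNumber_cyclicPolytope_eq_partialSums {n d : ℕ} {T : Finset ℝ}
    (hT : T.card = n + 1 + d) {k : ℕ} (hk : k ≤ d) :
    faceNumber (cyclicPolytope d T) ((k : ℤ) - 1) =
      partialSums^[d - k + 1] (cyclicHVector n d) k := by
  rw [faceNumber_cyclicPolytope hk, subsetPoly_isFaceSet hT, Polynomial.coeff_add,
    Polynomial.coeff_X_pow, if_neg (by omega), add_zero, coeff_cyclicPoly n hk]

theorem iterate_partialSums_cyclicHVector_pos (n m : ℕ) {d k : ℕ} (hk : k ≤ d) :
    0 < partialSums^[m] (cyclicHVector n d) k := by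
  induction m with
  | zero => exact cyclicHVector_pos n hk
  | succ m ih =>
    rw [Function.iterate_succ_apply']
    exact ih.trans_le
      (Finset.single_le_sum (fun _ _ => Nat.zero_le _) (Finset.self_mem_range_succ k))

/-- The last instance of log-concavity: the number of ridges is at most the square of the number
of facets. -/
theorem partialSums_partialSums_cyclicHVector_le (n k : ℕ) :
    partialSums (partialSums (cyclicHVector n (k + 1))) k ≤
      partialSums (cyclicHVector n (k + 1)) (k + 1) ^ 2 := by
  have hcard : k + 1 ≤ partialSums (cyclicHVector n (k + 1)) (k + 1) := by
    have := Finset.card_nsmul_le_sum (Finset.range (k + 1 + 1)) (cyclicHVector n (k + 1)) 1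
      fun i hi => cyclicHVector_pos n (Nat.lt_succ_iff.1 (Finset.mem_range.1 hi))
    rw [Finset.card_range, smul_eq_mul, mul_one] at this
    exact (Nat.le_succ _).trans this
  calc partialSums (partialSums (cyclicHVector n (k + 1))) k
      ≤ (Finset.range (k + 1)).card • partialSums (cyclicHVector n (k + 1)) (k + 1) :=
        Finset.sum_le_card_nsmul _ _ _ fun i hi =>
          monotone_partialSums _ (Finset.mem_range.1 hi).le
    _ ≤ _ := by
        rw [Finset.card_range, smul_eq_mul, sq]
        exact Nat.mul_le_mul_right _ hcard

theorem faceNumber_cyclicPolytope_mul_le {n d : ℕ} {T : Finset ℝ} (hT : T.card = n + 1 + d)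
    {k : ℕ} (hk : k + 2 ≤ d) :
    faceNumber (cyclicPolytope d T) ((k : ℤ) - 1) * faceNumber (cyclicPolytope d T) (k + 1) ≤
      faceNumber (cyclicPolytope d T) k ^ 2 := by
  have h0 := faceNumber_cyclicPolytope_eq_partialSums hT (k := k) (by omega)
  have h1 := faceNumber_cyclicPolytope_eq_partialSums hT (k := k + 1) (by omega)
  have h2 := faceNumber_cyclicPolytope_eq_partialSums hT hk
  obtain ⟨m, rfl⟩ : ∃ m, d = k + 2 + m := ⟨d - (k + 2), by omega⟩
  rw [show k + 2 + m - k + 1 = m + 1 + 1 + 1 by omega, Function.iterate_succ_apply',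
    Function.iterate_succ_apply'] at h0
  rw [show k + 2 + m - (k + 1) + 1 = m + 1 + 1 by omega, Function.iterate_succ_apply',
    show ((k + 1 : ℕ) : ℤ) - 1 = k by omega] at h1
  rw [show k + 2 + m - (k + 2) + 1 = m + 1 by omega,
    show ((k + 2 : ℕ) : ℤ) - 1 = k + 1 by omega] at h2
  rw [h0, h1, h2, mul_comm]
  exact ((stronglyLogConcave_cyclicHVector n _).iterate_partialSums
    (m + 1)).mul_partialSums_partialSums_le k

theorem mainTheorem1 (v d : ℕ) (hd : 1 ≤ d) (hv : d + 1 ≤ v) (T : Finset ℝ) (hT : T.card = v) :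
    IsLogConcaveSeq d (extendedFVector d (cyclicPolytope d T)) ∧
      IsUnimodalSeq d (faceNumber (cyclicPolytope d T)) := by
  obtain ⟨n, rfl⟩ : ∃ n, v = n + 1 + d := ⟨v - d - 1, by omega⟩
  have hlc : ∀ i : ℤ, -1 < i → i < (d : ℤ) - 1 →
      faceNumber (cyclicPolytope d T) (i - 1) * faceNumber (cyclicPolytope d T) (i + 1) ≤
        faceNumber (cyclicPolytope d T) i ^ 2 := by
    intro i hi hid
    obtain ⟨k, rfl⟩ := Int.eq_ofNat_of_zero_le (a := i) (by omega)
    exact faceNumber_cyclicPolytope_mul_le hT (by omega)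
  refine ⟨fun i hi hid => ?_, isUnimodalSeq_of_logConcave (fun i hi hid => ?_) hlc⟩
  · rw [extendedFVector, if_neg (by omega), extendedFVector, extendedFVector, if_neg hid.ne]
    split_ifs with h
    · obtain ⟨k, rfl⟩ := Int.eq_ofNat_of_zero_le (a := i) (by omega)
      obtain rfl : d = k + 1 := by omega
      have h0 := faceNumber_cyclicPolytope_eq_partialSums hT (k := k) (by omega)
      have h1 := faceNumber_cyclicPolytope_eq_partialSums hT (k := k + 1) le_rfl
      rw [show k + 1 - k + 1 = 2 by omega] at h0
      rw [Nat.sub_self, show ((k + 1 : ℕ) : ℤ) - 1 = k by omega] at h1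
      rw [mul_one, h0, h1]
      exact partialSums_partialSums_cyclicHVector_le n k
    · exact hlc i hi (by omega)
  · obtain ⟨k, hk⟩ := Int.eq_ofNat_of_zero_le (a := i + 1) (by omega)
    obtain rfl : i = (k : ℤ) - 1 := by omega
    rw [faceNumber_cyclicPolytope_eq_partialSums hT (by omega)]
    exact iterate_partialSums_cyclicHVector_pos n _ (by omega)
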